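/- Let $\mathbb F_2$ be the free group on two generators. For $n \in \mathbb N$ let $U(n)$ be the group of unitary $n \times n$ complex matrices, and let $\|\cdot\|$ denote the operator norm on complex $n\times n$ matrices induced by the Euclidean norm on $\mathbb C^n$. There exists a sequence $(z_k)_{k \in \mathbb N}$ of non-trivial elements of $\mathbb F_2$ with the following two properties. (1) For every compact topological group $K$ and every group homomorphism $\pi \colon \mathbb F_2 \to K$, one has $\pi(z_k) \to 1$ in $K$ as $k \to \infty$. (2) The convergence is uniform over unitary representations of a fixed finite dimension: for every $n \in \mathbb N$ and every $\varepsilon > 0$ there is $N \in \mathbb N$ such that $\|1 - \pi(z_k)\| < \varepsilon$ for all $k \ge N$ and all homomorphisms $\pi \colon \mathbb F_2 \to U(n)$. -/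

import Mathlib

open Filter Topology
open scoped Matrix.Norms.L2Operator

universe u

/-- The length `‖1 - g‖` of a unitary matrix `g`, where `‖·‖` is the operator norm on
`n × n` matrices induced by the Euclidean norm on `ℂⁿ`. -/
noncomputable def unitaryLength {n : ℕ} (g : Matrix.unitaryGroup (Fin n) ℂ) : ℝ :=
  ‖(1 : Matrix (Fin n) (Fin n) ℂ) - (g : Matrix (Fin n) (Fin n) ℂ)‖

open scoped commutatorElement

/-! ### Conjugation without cancellation in the free group -/

namespace FreeGroup

/-! Write ℓ(g) = ‖1 - g‖. Since ℓ([u, v]) ≤ 2ℓ(u)ℓ(v), once a power of a generator a lies within 1/4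
of 1, iterated commutators with conjugates shrink geometrically. Compactness of U(m) for m ≤ n
bounds the exponent needed by some M, but the exponent depends on the representation. So the words
built from all the powers a, ..., a^(M+1) are merged into one iterated commutator, which is small
when any entry is. Suitable conjugations keep each commutator non-trivial
(`exists_commutatorElement_conj_ne_one`). A diagonal choice over n gives (2).

Convergence in every U(n) implies (1) by a Peter-Weyl argument: on L²(K), a compact self-adjoint
operator commuting with translations has finite-dimensional invariant eigenspaces for its nonzero
eigenvalues, and there convergence is known. -/

theorem mk_eq_mk_of_isReduced {α : Type*} [DecidableEq α] {L₁ L₂ : List (α × Bool)}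
    (h₁ : IsReduced L₁) (h₂ : IsReduced L₂) (h : mk L₁ = mk L₂) : L₁ = L₂ := by
  rw [← h₁.reduce_eq, ← h₂.reduce_eq, ← toWord_mk, ← toWord_mk, h]

/-- In the free group on two generators, a nontrivial element does not commute with all the
conjugates of another nontrivial element. -/
theorem exists_commutatorElement_conj_ne_one {x y : FreeGroup (Fin 2)} (hx : x ≠ 1) (hy : y ≠ 1) :
    ∃ g : FreeGroup (Fin 2), ⁅x, g * y * g⁻¹⁆ ≠ 1 := by
  -- Of the four letters, at most two are forbidden for p (so that p y p⁻¹ is reduced), and at most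
  -- three for q. The condition q ≠ a serves twice: q⁻¹x does not cancel, and the two products below
  -- start with different letters.
  have letter_y : ∀ a b : Fin 2 × Bool, ∃ p : Fin 2 × Bool,
      (p.1 = a.1 → p.2 = a.2) ∧ (b.1 = p.1 → b.2 = !p.2) := by decide
  have letter_x : ∀ a b p : Fin 2 × Bool, ∃ q : Fin 2 × Bool,
      (b.1 = q.1 → b.2 = q.2) ∧ q ≠ a ∧ (q.1 = p.1 → q.2 = p.2) := by decide
  have hX : x.toWord ≠ [] := fun h => hx (toWord_eq_nil_iff.1 h)
  have hY : y.toWord ≠ [] := fun h => hy (toWord_eq_nil_iff.1 h)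
  obtain ⟨p, hp₁, hp₂⟩ := letter_y (y.toWord.head hY) (y.toWord.getLast hY)
  obtain ⟨q, hq₁, hq₂, hq₃⟩ := letter_x (x.toWord.head hX) (x.toWord.getLast hX) p
  set L : List (Fin 2 × Bool) := [q, p] ++ y.toWord ++ [(p.1, !p.2), (q.1, !q.2)] with hL
  have hmk : mk [q, p] * y * (mk [q, p])⁻¹ = mk L := by
    rw [hL, ← mul_mk, ← mul_mk, mk_toWord]
    simp [invRev]
  have hyr : y.toWord.IsChain fun a b ↦ a.1 = b.1 → a.2 = b.2 := isReduced_toWord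
  have hxr : x.toWord.IsChain fun a b ↦ a.1 = b.1 → a.2 = b.2 := isReduced_toWord
  have hLr : IsReduced L := by
    simp only [IsReduced, hL, List.isChain_append, List.isChain_cons_cons,
      List.head?_eq_some_head hY]
    simp_all [List.head?_eq_some_head, List.getLast?_eq_some_getLast]
  have h₁ : IsReduced (x.toWord ++ L) := by
    refine List.isChain_append.2 ⟨hxr, hLr, fun a ha b hb => ?_⟩
    simp only [List.getLast?_eq_some_getLast hX, Option.mem_some_iff] at ha
    simp only [hL, List.cons_append, List.head?_cons, Option.mem_some_iff] at hb
    subst ha hb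
    exact hq₁
  have h₂ : IsReduced (L ++ x.toWord) := by
    refine List.isChain_append.2 ⟨hLr, hxr, fun a ha b hb => ?_⟩
    rw [hL, List.getLast?_append] at ha
    simp only [List.head?_eq_some_head hX, Option.mem_some_iff] at hb
    simp only [List.getLast?_cons_cons, List.getLast?_singleton, Option.some_or,
      Option.mem_some_iff] at ha
    subst ha hb
    intro h
    by_contra h'
    exact hq₂ (Prod.ext h (by simpa [eq_comm] using h'))
  refine ⟨mk [q, p], fun h => ?_⟩
  rw [commutatorElement_eq_one_iff_mul_comm, hmk] at h
  nth_rewrite 1 [← mk_toWord (x := x)] at h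
  nth_rewrite 2 [← mk_toWord (x := x)] at h
  rw [mul_mk, mul_mk] at h
  have := congrArg List.head? (mk_eq_mk_of_isReduced h₁ h₂ h)
  simp [hL, List.head?_append, List.head?_eq_some_head hX] at this
  exact hq₂ this.symm

end FreeGroup

/-! ### Commutator estimates for unitaries -/

section Unitary

variable {A : Type*} [NormedRing A] [StarRing A] [CStarRing A]

/-- Multiplying by the unitary vu turns 1 - [u, v] into vu - uv, which is the commutator of 1 - v
and 1 - u. -/
theorem norm_one_sub_unitary_comm (u v : unitary A) :
    ‖(1 : A) - (⁅u, v⁆ : unitary A)‖ ≤ 2 * ‖(1 : A) - u‖ * ‖(1 : A) - v‖ := by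
  have h : ((1 : A) - (⁅u, v⁆ : unitary A)) * ((v * u : unitary A) : A)
      = (1 - (v : A)) * (1 - u) - (1 - (u : A)) * (1 - v) := by
    rw [sub_mul, ← Submonoid.coe_mul, commutatorElement_def,
      show u * v * u⁻¹ * v⁻¹ * (v * u) = u * v by group]
    push_cast
    noncomm_ring
  rw [← CStarRing.norm_mul_coe_unitary _ (v * u), h]
  calc _ ≤ ‖(1 - (v : A)) * (1 - u)‖ + ‖(1 - (u : A)) * (1 - v)‖ := norm_sub_le _ _
    _ ≤ ‖1 - (v : A)‖ * ‖1 - (u : A)‖ + ‖1 - (u : A)‖ * ‖1 - (v : A)‖ := by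
      gcongr <;> exact norm_mul_le _ _
    _ = _ := by ring

theorem norm_one_sub_unitary_conj (g u : unitary A) :
    ‖(1 : A) - (g * u * g⁻¹ : unitary A)‖ = ‖(1 : A) - u‖ := by
  have h : (1 : A) - (g * u * g⁻¹ : unitary A) = g * (1 - (u : A)) * (g⁻¹ : unitary A) := by
    rw [mul_sub, sub_mul, mul_one, ← Submonoid.coe_mul, mul_inv_cancel]
    simp
  rw [h, CStarRing.norm_mul_coe_unitary, CStarRing.norm_coe_unitary_mul]

theorem norm_coe_unitary_le_one (u : unitary A) : ‖(u : A)‖ ≤ 1 := by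
  rcases subsingleton_or_nontrivial A with _ | _
  · simp [Subsingleton.elim (u : A) 0]
  · exact (CStarRing.norm_coe_unitary u).le

theorem norm_one_sub_unitary_le_two (u : unitary A) : ‖(1 : A) - u‖ ≤ 2 := by
  calc ‖(1 : A) - u‖ ≤ ‖((1 : unitary A) : A)‖ + ‖(u : A)‖ := norm_sub_le _ _
    _ ≤ 1 + 1 := add_le_add (norm_coe_unitary_le_one _) (norm_coe_unitary_le_one _)
    _ = 2 := by norm_num

end Unitary

/-! ### Almost laws for unitary groups -/

instance Matrix.compactSpace_unitaryGroup (n : ℕ) :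
    CompactSpace (Matrix.unitaryGroup (Fin n) ℂ) := by
  have : ProperSpace (Matrix (Fin n) (Fin n) ℂ) := FiniteDimensional.proper ℂ _
  refine isCompact_iff_compactSpace.1 (Metric.isCompact_of_isClosed_isBounded isClosed_unitary ?_)
  refine isBounded_iff_forall_norm_le.2 ⟨1, fun a ha => norm_coe_unitary_le_one ⟨a, ha⟩⟩

/-- The powers of g cluster at 1, so a positive one lies in the interior of U; finitely many
exponents suffice by compactness. -/
theorem exists_forall_exists_pow_mem_of_mem_nhds_one {G : Type*} [Group G] [TopologicalSpace G]
    [CompactSpace G] [IsTopologicalGroup G] {U : Set G} (hU : U ∈ 𝓝 (1 : G)) :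
    ∃ M : ℕ, ∀ g : G, ∃ j, j ≠ 0 ∧ j ≤ M ∧ g ^ j ∈ U := by
  have hcover : ∀ g : G, ∃ j : ℕ, j ≠ 0 ∧ g ^ j ∈ interior U := fun g =>
    (((mapClusterPt_one_atTop_pow g).frequently
      (interior_mem_nhds.2 hU)).and_eventually (eventually_ne_atTop 0)).exists.imp
      fun _ h => ⟨h.2, h.1⟩
  obtain ⟨t, ht⟩ := isCompact_univ.elim_finite_subcover
    (fun j : {j : ℕ // j ≠ 0} => (fun g : G => g ^ (j : ℕ)) ⁻¹' interior U)
    (fun j => isOpen_interior.preimage (continuous_pow _))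
    (fun g _ => Set.mem_iUnion.2 <| (hcover g).elim fun j hj => ⟨⟨j, hj.1⟩, hj.2⟩)
  refine ⟨t.sup (fun j => (j : ℕ)), fun g => ?_⟩
  obtain ⟨j, hjt, hj⟩ := Set.mem_iUnion₂.1 (ht (Set.mem_univ g))
  exact ⟨j, j.2, Finset.le_sup (f := fun j : {j : ℕ // j ≠ 0} => (j : ℕ)) hjt,
    interior_subset hj⟩

theorem exists_forall_exists_norm_one_sub_pow_le (n : ℕ) {δ : ℝ} (hδ : 0 < δ) :
    ∃ M : ℕ, ∀ m ≤ n, ∀ u : Matrix.unitaryGroup (Fin m) ℂ, ∃ j, j ≠ 0 ∧ j ≤ M ∧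
      ‖(1 : Matrix (Fin m) (Fin m) ℂ) - (u ^ j : Matrix.unitaryGroup (Fin m) ℂ)‖ ≤ δ := by
  have h : ∀ m : ℕ, ∃ M : ℕ, ∀ u : Matrix.unitaryGroup (Fin m) ℂ, ∃ j, j ≠ 0 ∧ j ≤ M ∧
      ‖(1 : Matrix (Fin m) (Fin m) ℂ) - (u ^ j : Matrix.unitaryGroup (Fin m) ℂ)‖ ≤ δ := by
    intro m
    refine exists_forall_exists_pow_mem_of_mem_nhds_one
      (U := {u : Matrix.unitaryGroup (Fin m) ℂ |
        ‖(1 : Matrix (Fin m) (Fin m) ℂ) - (u : Matrix (Fin m) (Fin m) ℂ)‖ ≤ δ}) ?_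
    have hc : Continuous fun u : Matrix.unitaryGroup (Fin m) ℂ =>
        ‖(1 : Matrix (Fin m) (Fin m) ℂ) - (u : Matrix (Fin m) (Fin m) ℂ)‖ := by fun_prop
    exact hc.continuousAt.eventually_le_const (by simpa using hδ)
  choose M hM using h
  refine ⟨(Finset.range (n + 1)).sup M, fun m hm u => ?_⟩
  obtain ⟨j, hj₀, hjM, hj⟩ := hM m u
  exact ⟨j, hj₀, hjM.trans (Finset.le_sup (Finset.mem_range_succ_iff.2 hm)), hj⟩

/-- Commutators with conjugates contract the elements close to `1`, uniformly. -/
theorem exists_ne_one_forall_norm_one_sub_le {x : FreeGroup (Fin 2)} (hx : x ≠ 1) (t : ℕ) :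
    ∃ c : FreeGroup (Fin 2), c ≠ 1 ∧
      ∀ (m : ℕ) (π : FreeGroup (Fin 2) →* Matrix.unitaryGroup (Fin m) ℂ),
        unitaryLength (π x) ≤ 1 / 4 → unitaryLength (π c) ≤ 1 / 4 * (1 / 2) ^ t := by
  induction t with
  | zero => exact ⟨x, hx, fun m π h => by simpa using h⟩
  | succ t ih =>
    obtain ⟨c, hc, h⟩ := ih
    obtain ⟨g, hg⟩ := FreeGroup.exists_commutatorElement_conj_ne_one hc hc
    refine ⟨_, hg, fun m π hπ => ?_⟩
    have h₀ : 0 ≤ unitaryLength (π c) := norm_nonneg _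
    have h₁ := h m π hπ
    have h₂ : unitaryLength (π c) ≤ 1 / 4 :=
      h₁.trans (mul_le_of_le_one_right (by norm_num) (pow_le_one₀ (by norm_num) (by norm_num)))
    rw [map_commutatorElement, map_mul, map_mul, map_inv]
    calc unitaryLength ⁅π c, π g * π c * (π g)⁻¹⁆
        ≤ 2 * unitaryLength (π c) * unitaryLength (π g * π c * (π g)⁻¹) :=
          norm_one_sub_unitary_comm _ _
      _ = 2 * unitaryLength (π c) * unitaryLength (π c) := by
          congr 1; exact norm_one_sub_unitary_conj _ _
      -- For ℓ ≤ 1/4 one has 2ℓ² ≤ ℓ/2: each commutator halves the bound.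
      _ ≤ 2 * unitaryLength (π c) * (1 / 4) := by gcongr
      _ ≤ 2 * (1 / 4 * (1 / 2) ^ t) * (1 / 4) := by gcongr
      _ = 1 / 4 * (1 / 2) ^ (t + 1) := by ring

/-- An iterated commutator is close to `1` as soon as one of its entries is. -/
theorem exists_ne_one_forall_norm_one_sub_le_mul {c : ℕ → FreeGroup (Fin 2)}
    (hc : ∀ j, c j ≠ 1) (M : ℕ) :
    ∃ w : FreeGroup (Fin 2), w ≠ 1 ∧
      ∀ (m : ℕ) (π : FreeGroup (Fin 2) →* Matrix.unitaryGroup (Fin m) ℂ), ∀ j ≤ M,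
        unitaryLength (π w) ≤ 4 ^ M * unitaryLength (π (c j)) := by
  induction M with
  | zero => exact ⟨c 0, hc 0, fun m π j hj => by simp [Nat.le_zero.1 hj]⟩
  | succ M ih =>
    obtain ⟨w, hw, h⟩ := ih
    obtain ⟨g, hg⟩ := FreeGroup.exists_commutatorElement_conj_ne_one hw (hc (M + 1))
    refine ⟨_, hg, fun m π j hj => ?_⟩
    have h₀ : ∀ x, 0 ≤ unitaryLength (π x) := fun x => norm_nonneg _
    have h₂ : ∀ x, unitaryLength (π x) ≤ 2 := fun x => norm_one_sub_unitary_le_two _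
    rw [map_commutatorElement, map_mul, map_mul, map_inv]
    have key : unitaryLength ⁅π w, π g * π (c (M + 1)) * (π g)⁻¹⁆
        ≤ 2 * unitaryLength (π w) * unitaryLength (π (c (M + 1))) :=
      (norm_one_sub_unitary_comm _ _).trans_eq <| by
        congr 1; exact norm_one_sub_unitary_conj _ _
    refine key.trans ?_
    -- Keep the factor containing the entry j and bound the other by 2; this costs 2 · 2 = 4 per
    -- stage.
    rcases hj.lt_or_eq with hj | rfl
    · calc _ ≤ 2 * (4 ^ M * unitaryLength (π (c j))) * 2 := by
            have := h₀ (c j)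
            gcongr
            · exact h₀ _
            · exact h m π j (Nat.lt_succ_iff.1 hj)
            · exact h₂ _
        _ = _ := by ring
    · calc _ ≤ 2 * 2 * unitaryLength (π (c (M + 1))) := by
            gcongr
            · exact h₀ _
            · exact h₂ _
        _ = 4 * 1 * unitaryLength (π (c (M + 1))) := by ring
        _ ≤ 4 * 4 ^ M * unitaryLength (π (c (M + 1))) := by
            gcongr
            · exact h₀ _
            · exact one_le_pow₀ (by norm_num)
        _ = _ := by ring

/-- For every dimension there are nontrivial almost laws for the unitary groups. -/
theorem exists_ne_one_forall_unitaryLength_lt (n : ℕ) {ε : ℝ} (hε : 0 < ε) :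
    ∃ w : FreeGroup (Fin 2), w ≠ 1 ∧ ∀ m ≤ n,
      ∀ π : FreeGroup (Fin 2) →* Matrix.unitaryGroup (Fin m) ℂ, unitaryLength (π w) < ε := by
  obtain ⟨M, hM⟩ := exists_forall_exists_norm_one_sub_pow_le n (δ := 1 / 4) (by norm_num)
  -- M does not depend on t, so t can be chosen to beat the loss 4^M.
  obtain ⟨t, ht⟩ := exists_pow_lt_of_lt_one (y := (1 / 2 : ℝ)) (x := ε / 4 ^ M) (by positivity)
    (by norm_num)
  have hpow : ∀ j : ℕ, FreeGroup.of (0 : Fin 2) ^ (j + 1) ≠ 1 := fun j h =>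
    FreeGroup.of_ne_one _ ((pow_eq_one_iff_left j.succ_ne_zero).1 h)
  choose c hc h using fun j => exists_ne_one_forall_norm_one_sub_le (hpow j) t
  obtain ⟨w, hw, hwM⟩ := exists_ne_one_forall_norm_one_sub_le_mul hc M
  refine ⟨w, hw, fun m hm π => ?_⟩
  obtain ⟨j, hj₀, hjM, hj⟩ := hM m hm (π (FreeGroup.of 0))
  obtain ⟨i, rfl⟩ := Nat.exists_eq_succ_of_ne_zero hj₀
  calc unitaryLength (π w) ≤ 4 ^ M * unitaryLength (π (c i)) := hwM m π i (by omega)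
    _ ≤ 4 ^ M * (1 / 4 * (1 / 2) ^ t) := by
      gcongr
      refine h i m π ?_
      rw [map_pow]
      exact hj
    _ ≤ 4 ^ M * (1 / 2) ^ t := by
      gcongr
      exact mul_le_of_le_one_left (by positivity) (by norm_num)
    _ < 4 ^ M * (ε / 4 ^ M) := by gcongr
    _ = ε := by field_simp

/-- A sequence converging to `1` in all the unitary groups, uniformly over the homomorphisms. -/
theorem exists_seq_ne_one_forall_unitaryLength_lt :
    ∃ z : ℕ → FreeGroup (Fin 2), (∀ k, z k ≠ 1) ∧
      ∀ (n : ℕ) (ε : ℝ), 0 < ε → ∃ N : ℕ, ∀ k : ℕ, N ≤ k →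
        ∀ π : FreeGroup (Fin 2) →* Matrix.unitaryGroup (Fin n) ℂ,
          unitaryLength (π (z k)) < ε := by
  -- Diagonal choice: z k serves all dimensions up to k with error 1/(k+1).
  choose z hz h using fun k : ℕ =>
    exists_ne_one_forall_unitaryLength_lt k (Nat.one_div_pos_of_nat (α := ℝ) (n := k))
  refine ⟨z, hz, fun n ε hε => ?_⟩
  obtain ⟨N, hN⟩ := exists_nat_one_div_lt hε
  refine ⟨max N n, fun k hk π => (h k n ((le_max_right _ _).trans hk) π).trans ?_⟩
  refine lt_of_le_of_lt ?_ hN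
  have : N ≤ k := (le_max_left _ _).trans hk
  gcongr

/-! ### Averaged rank one operators and Peter-Weyl -/

open MeasureTheory InnerProductSpace

theorem isCompactOperator_rankOne {H : Type*} [NormedAddCommGroup H] [InnerProductSpace ℂ H]
    (x y : H) : IsCompactOperator (rankOne ℂ x y : H →L[ℂ] H) := by
  have h : (rankOne ℂ x y : H →L[ℂ] H)
      = (ContinuousLinearMap.toSpanSingleton ℂ x).comp (innerSL ℂ y) := by
    ext z; simp
  rw [h, ContinuousLinearMap.coe_comp]
  exact (isCompactOperator_of_locallyCompactSpace_dom (innerSL ℂ y)).clm_comp _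

theorem Continuous.integrable_of_compactSpace {X E : Type*} [TopologicalSpace X] [CompactSpace X]
    [MeasurableSpace X] [OpensMeasurableSpace X] {μ : Measure X} [IsFiniteMeasureOnCompacts μ]
    [NormedAddCommGroup E] {f : X → E} (hf : Continuous f) : Integrable f μ :=
  hf.integrable_of_hasCompactSupport (HasCompactSupport.of_compactSpace f)

section OrbitOperator

variable {K : Type*} [Group K] [TopologicalSpace K] [MeasurableSpace K]
  {H : Type*} [NormedAddCommGroup H] [InnerProductSpace ℂ H]

/-- The average of the rank one operators `f ↦ ⟪ρ g v, f⟫ • ρ g v` over a group. -/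
noncomputable def orbitOperator (μ : Measure K) (ρ : K →* (H ≃ₗᵢ[ℂ] H)) (v : H) : H →L[ℂ] H :=
  ∫ g, rankOne ℂ (ρ g v) (ρ g v) ∂μ

variable [CompactSpace K] [BorelSpace K] [CompleteSpace H]
  {μ : Measure K} [IsProbabilityMeasure μ]
  {ρ : K →* (H ≃ₗᵢ[ℂ] H)} {v : H}

theorem integrable_rankOne_orbit (hρ : Continuous fun g => ρ g v) :
    Integrable (fun g => (rankOne ℂ (ρ g v) (ρ g v) : H →L[ℂ] H)) μ := by
  refine Continuous.integrable_of_compactSpace ?_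
  exact ((ContinuousLinearMap.smulRightL ℂ H H).continuous.comp
    ((innerSL ℂ).continuous.comp hρ)).clm_apply hρ

theorem orbitOperator_apply (hρ : Continuous fun g => ρ g v) (f : H) :
    orbitOperator μ ρ v f = ∫ g, inner ℂ (ρ g v) f • ρ g v ∂μ := by
  rw [orbitOperator, ContinuousLinearMap.integral_apply (integrable_rankOne_orbit hρ)]
  simp

theorem inner_orbitOperator (hρ : Continuous fun g => ρ g v) (f f' : H) :
    inner ℂ f (orbitOperator μ ρ v f') = ∫ g, inner ℂ (ρ g v) f' * inner ℂ f (ρ g v) ∂μ := by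
  rw [orbitOperator_apply hρ, ← integral_inner]
  · simp only [inner_smul_right]
  · exact Continuous.integrable_of_compactSpace (by fun_prop)

theorem isSymmetric_orbitOperator (hρ : Continuous fun g => ρ g v) :
    (orbitOperator μ ρ v).IsSymmetric := by
  intro x y
  change inner ℂ (orbitOperator μ ρ v x) y = inner ℂ x (orbitOperator μ ρ v y)
  rw [← inner_conj_symm, inner_orbitOperator hρ, inner_orbitOperator hρ, ← integral_conj]
  simp only [map_mul, inner_conj_symm, mul_comm]

/-- Compact operators form a closed convex set, which contains averages of its members. -/
theorem isCompactOperator_orbitOperator (hρ : Continuous fun g => ρ g v) :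
    IsCompactOperator (orbitOperator μ ρ v) := by
  have hconv : Convex ℝ {T : H →L[ℂ] H | IsCompactOperator T} :=
    ((compactOperator (RingHom.id ℂ) H H).restrictScalars ℝ).convex
  exact hconv.integral_mem isClosed_setOfPred_isCompactOperator
    (ae_of_all _ fun g => isCompactOperator_rankOne _ _) (integrable_rankOne_orbit hρ)

theorem orbitOperator_map [IsTopologicalGroup K] [μ.IsMulLeftInvariant]
    (hρ : Continuous fun g => ρ g v) (h : K) (f : H) : orbitOperator μ ρ v (ρ h f) = ρ h (orbitOperator μ ρ v f) := by
  rw [orbitOperator_apply hρ, orbitOperator_apply hρ,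
    ← integral_mul_left_eq_self (fun g => inner ℂ (ρ g v) (ρ h f) • ρ g v) h]
  refine Eq.trans ?_ ((ρ h).toContinuousLinearEquiv.integral_comp_comm _)
  simp

/-- ⟪f, Tf⟫ is the integral of |⟪ρ g v, f⟫|², a continuous function that therefore vanishes, in
particular at g = 1. -/
theorem inner_eq_zero_of_orbitOperator_eq_zero [μ.IsOpenPosMeasure]
    (hρ : Continuous fun g => ρ g v) {f : H} (hf : orbitOperator μ ρ v f = 0) :
    inner ℂ v f = 0 := by
  have h : ∫ g, ‖inner ℂ (ρ g v) f‖ ^ 2 ∂μ = 0 := by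
    have h' := inner_orbitOperator (μ := μ) hρ f f
    rw [hf, inner_zero_right] at h'
    have h'' : ∀ g, inner ℂ (ρ g v) f * inner ℂ f (ρ g v)
        = ((‖inner ℂ (ρ g v) f‖ ^ 2 : ℝ) : ℂ) := fun g => by
      rw [← inner_conj_symm f, Complex.mul_conj, Complex.normSq_eq_norm_sq]
    simp only [h''] at h'
    rw [integral_complex_ofReal] at h'
    exact_mod_cast h'.symm
  by_contra hne
  have hcont : Continuous fun g => ‖inner ℂ (ρ g v) f‖ ^ 2 := by fun_prop
  refine (hcont.integral_pos_of_hasCompactSupport_nonneg_nonzero (μ := μ) (x := 1)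
    (HasCompactSupport.of_compactSpace _) (fun g => sq_nonneg _) ?_).ne' h
  simpa using hne

end OrbitOperator

/-- The vectors that a family of isometries moves less and less. -/
def Submodule.asymptoticallyFixed {ι H : Type*} [NormedAddCommGroup H] [InnerProductSpace ℂ H]
    (T : ι → H ≃ₗᵢ[ℂ] H) (l : Filter ι) : Submodule ℂ H where
  carrier := {v | Tendsto (fun i => T i v) l (𝓝 v)}
  add_mem' {v w} (hv hw) := by
    simpa using Tendsto.add (show Tendsto _ _ _ from hv) (show Tendsto _ _ _ from hw)
  zero_mem' := by simpa using tendsto_const_nhds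
  smul_mem' c v hv := by
    simpa using Tendsto.const_smul (show Tendsto _ _ _ from hv) c

theorem Submodule.isClosed_asymptoticallyFixed {ι H : Type*} [NormedAddCommGroup H]
    [InnerProductSpace ℂ H] (T : ι → H ≃ₗᵢ[ℂ] H) (l : Filter ι) :
    IsClosed (Submodule.asymptoticallyFixed T l : Set H) := by
  refine isClosed_of_closure_subset fun v hv => ?_
  change Tendsto (fun i => T i v) l (𝓝 v)
  rw [Metric.tendsto_nhds]
  intro ε hε
  obtain ⟨w, hw, hvw⟩ := Metric.mem_closure_iff.1 hv (ε / 3) (by positivity)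
  have hw : Tendsto (fun i => T i w) l (𝓝 w) := hw
  filter_upwards [Metric.tendsto_nhds.1 hw (ε / 3) (by positivity)] with i hi
  calc dist (T i v) v ≤ dist (T i v) (T i w) + dist (T i w) w + dist w v :=
        dist_triangle4 _ _ _ _
    _ < ε / 3 + ε / 3 + ε / 3 := by
        rw [(T i).dist_map, dist_comm w v]
        gcongr
    _ = ε := by ring

/-- A consequence of the Peter-Weyl theorem: for a continuous unitary representation of a compact
group, strong convergence to the identity can be tested on finite dimensional invariant
subspaces. -/
theorem tendsto_apply_of_forall_finiteDimensional_invariant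
    {K : Type*} [Group K] [TopologicalSpace K] [MeasurableSpace K]
    [IsTopologicalGroup K] [CompactSpace K] [BorelSpace K]
    {H : Type*} [NormedAddCommGroup H] [InnerProductSpace ℂ H] [CompleteSpace H]
    (μ : Measure K) [IsProbabilityMeasure μ] [μ.IsMulLeftInvariant] [μ.IsOpenPosMeasure]
    {ρ : K →* (H ≃ₗᵢ[ℂ] H)} {v : H} (hρ : Continuous fun g => ρ g v)
    {ι : Type*} {l : Filter ι} {g : ι → K}
    (hg : ∀ W : Submodule ℂ H, FiniteDimensional ℂ W → (∀ k : K, ∀ w ∈ W, ρ k w ∈ W) →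
      ∀ w ∈ W, Tendsto (fun i => ρ (g i) w) l (𝓝 w)) :
    Tendsto (fun i => ρ (g i) v) l (𝓝 v) := by
  set T := orbitOperator μ ρ v
  have hTs : T.IsSymmetric := isSymmetric_orbitOperator hρ
  have hTc : IsCompactOperator T := isCompactOperator_orbitOperator hρ
  set S := Submodule.asymptoticallyFixed (fun i => ρ (g i)) l
  have hE : ∀ ν : ℂ, ν ≠ 0 → Module.End.eigenspace (T : Module.End ℂ H) ν ≤ S := by
    intro ν hν
    refine fun w hw => hg _ (ContinuousLinearMap.finite_dimensional_eigenspace hTc ν hν) ?_ w hw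
    intro k w hw
    rw [Module.End.mem_eigenspace_iff] at hw ⊢
    change T (ρ k w) = ν • ρ k w
    change T w = ν • w at hw
    rw [orbitOperator_map hρ, hw, map_smul]
  suffices hv : v ∈ S.topologicalClosure from
    Submodule.topologicalClosure_minimal _ le_rfl
      (Submodule.isClosed_asymptoticallyFixed (fun i => ρ (g i)) l) hv
  rw [← Submodule.orthogonal_orthogonal_eq_closure, Submodule.mem_orthogonal']
  intro s hs
  -- It suffices that Ts = 0, i.e. that Ts is orthogonal to all eigenvectors e. By symmetry ⟪e, Ts⟫
  -- = ⟪Te, s⟫, which is zero if ν = 0, and otherwise because e ∈ S.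
  refine inner_eq_zero_of_orbitOperator_eq_zero (μ := μ) hρ ?_
  have hbot := ContinuousLinearMap.orthogonalComplement_iSup_eigenspaces_eq_bot hTc hTs
  rw [← Submodule.mem_bot ℂ, ← hbot, Submodule.mem_orthogonal]
  intro e he
  induction he using Submodule.iSup_induction' with
  | mem ν e he =>
    have he' : T e = ν • e := Module.End.mem_eigenspace_iff.1 he
    have hsymm : inner ℂ (T e) s = inner ℂ e (T s) := hTs e s
    rw [← hsymm, he']
    rcases eq_or_ne ν 0 with rfl | hν
    · simp
    · rw [inner_smul_left, (Submodule.mem_orthogonal _ _).1 hs e (hE ν hν he), mul_zero]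
  | zero => simp
  | add x y _ _ hx hy => rw [inner_add_left, hx, hy, add_zero]

/-- The restriction of a linear isometric equivalence to a subspace that it and its inverse leave
invariant. -/
def LinearIsometryEquiv.restrictInvariant {H : Type*} [NormedAddCommGroup H]
    [InnerProductSpace ℂ H] (W : Submodule ℂ H) (T : H ≃ₗᵢ[ℂ] H) (h : ∀ w ∈ W, T w ∈ W)
    (h' : ∀ w ∈ W, T.symm w ∈ W) : W ≃ₗᵢ[ℂ] W where
  toLinearEquiv := LinearEquiv.ofLinearMap
    ((T.toLinearEquiv : H →ₗ[ℂ] H).restrict h) ((T.symm.toLinearEquiv : H →ₗ[ℂ] H).restrict h')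
    (by ext; simp) (by ext; simp)
  norm_map' w := T.norm_map w

/-- An orthonormal basis of W turns the restricted representation into unitary matrices without
changing operator norms. -/
theorem exists_monoidHom_unitaryGroup_norm_sub_le {G H : Type*} [Group G] [NormedAddCommGroup H]
    [InnerProductSpace ℂ H] (ρ : G →* (H ≃ₗᵢ[ℂ] H)) (W : Submodule ℂ H) [FiniteDimensional ℂ W]
    (hW : ∀ x : G, ∀ w ∈ W, ρ x w ∈ W) :
    ∃ (n : ℕ) (π : G →* Matrix.unitaryGroup (Fin n) ℂ),
      ∀ x : G, ∀ w ∈ W, ‖ρ x w - w‖ ≤ unitaryLength (π x) * ‖w‖ := by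
  have hsymm : ∀ x, (ρ x).symm = ρ x⁻¹ := fun x => (map_inv ρ x).symm
  let σ : G →* (W ≃ₗᵢ[ℂ] W) :=
    { toFun := fun x => (ρ x).restrictInvariant W (hW x) (by rw [hsymm]; exact hW x⁻¹)
      map_one' := by
        ext w
        change ρ 1 (w : H) = w
        simp
      map_mul' := fun x y => by
        ext w
        change ρ (x * y) (w : H) = ρ x (ρ y w)
        simp }
  let e := (stdOrthonormalBasis ℂ W).repr
  let Φ : (W →L[ℂ] W) ≃⋆ₐ[ℂ] Matrix (Fin (Module.finrank ℂ W)) (Fin (Module.finrank ℂ W)) ℂ :=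
    e.conjStarAlgEquiv.trans Matrix.toEuclideanCLM.symm
  let Φ' : (W →L[ℂ] W) →⋆* Matrix (Fin (Module.finrank ℂ W)) (Fin (Module.finrank ℂ W)) ℂ :=
    { toFun := Φ
      map_one' := map_one Φ
      map_mul' := map_mul Φ
      map_star' := fun a => Φ.map_star' a }
  let ψ : G →* unitary (W →L[ℂ] W) := Unitary.linearIsometryEquiv.symm.toMonoidHom.comp σ
  let π : G →* Matrix.unitaryGroup (Fin (Module.finrank ℂ W)) ℂ :=
    (Unitary.map Φ').toMonoidHom.comp ψ
  refine ⟨Module.finrank ℂ W, π, fun x w hw => ?_⟩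
  have hlen : unitaryLength (π x) = ‖e.conjStarAlgEquiv (1 - (ψ x : W →L[ℂ] W))‖ := by
    have h : (1 : Matrix (Fin (Module.finrank ℂ W)) (Fin (Module.finrank ℂ W)) ℂ) - (π x).1
        = Φ (1 - (ψ x : W →L[ℂ] W)) := by
      rw [map_sub, map_one]
      rfl
    rw [unitaryLength, h, Matrix.cstar_norm_def]
    simp [Φ]
  rw [hlen]
  calc ‖ρ x w - w‖ = ‖(1 - (ψ x : W →L[ℂ] W)) ⟨w, hw⟩‖ := by
        rw [norm_sub_rev]; rfl
    _ = ‖e.conjStarAlgEquiv (1 - (ψ x : W →L[ℂ] W)) (e ⟨w, hw⟩)‖ := by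
        rw [LinearIsometryEquiv.conjStarAlgEquiv_apply_apply, e.symm_apply_apply, e.norm_map]
    _ ≤ ‖e.conjStarAlgEquiv (1 - (ψ x : W →L[ℂ] W))‖ * ‖e ⟨w, hw⟩‖ :=
        ContinuousLinearMap.le_opNorm _ _
    _ = _ := by rw [e.norm_map]; rfl

/-! ### The regular representation and compact groups -/

section RegularRepresentation

variable {K : Type*} [Group K] [MeasurableSpace K] [MeasurableMul K]
  (μ : Measure K) [μ.IsMulLeftInvariant]

/-- The left regular representation of a group on the square integrable functions. -/
noncomputable def leftRegularRepresentation : K →* (Lp ℂ 2 μ ≃ₗᵢ[ℂ] Lp ℂ 2 μ) where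
  toFun g :=
    { toFun := fun f => DomMulAct.mk g⁻¹ • f
      invFun := fun f => DomMulAct.mk g • f
      map_add' := fun f f' => DomMulAct.smul_Lp_add _ f f'
      map_smul' := fun c f => smul_comm _ c f
      left_inv := fun f => by
        change DomMulAct.mk g • DomMulAct.mk g⁻¹ • f = f
        rw [smul_smul, ← DomMulAct.mk_mul, inv_mul_cancel, DomMulAct.mk_one, one_smul]
      right_inv := fun f => by
        change DomMulAct.mk g⁻¹ • DomMulAct.mk g • f = f
        rw [smul_smul, ← DomMulAct.mk_mul, mul_inv_cancel, DomMulAct.mk_one, one_smul]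
      norm_map' := fun f => DomMulAct.norm_smul_Lp _ f }
  map_one' := by
    ext1 f
    change DomMulAct.mk (1 : K)⁻¹ • f = f
    simp
  map_mul' g h := by
    ext1 f
    change DomMulAct.mk (g * h)⁻¹ • f = DomMulAct.mk g⁻¹ • DomMulAct.mk h⁻¹ • f
    rw [smul_smul, ← DomMulAct.mk_mul, mul_inv_rev]

theorem leftRegularRepresentation_apply (g : K) (f : Lp ℂ 2 μ) :
    leftRegularRepresentation μ g f = DomMulAct.mk g⁻¹ • f := rfl

end RegularRepresentation

/-- Convergence to `1` in a compact group can be tested on the left regular representation. -/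
theorem tendsto_one_of_tendsto_leftRegularRepresentation {K : Type*} [Group K]
    [TopologicalSpace K] [IsTopologicalGroup K] [MeasurableSpace K] [BorelSpace K]
    (μ : Measure K) [IsFiniteMeasure μ] [μ.IsMulLeftInvariant] [μ.IsOpenPosMeasure]
    {ι : Type*} {l : Filter ι} {g : ι → K}
    (h : ∀ f : Lp ℂ 2 μ, Tendsto (fun i => leftRegularRepresentation μ (g i) f) l (𝓝 f)) :
    Tendsto g l (𝓝 1) := by
  intro U hU
  obtain ⟨V, hVo, hV1, hVU⟩ : ∃ V : Set K, IsOpen V ∧ (1 : K) ∈ V ∧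
      ∀ v ∈ V, ∀ w ∈ V, v / w ∈ U := by
    obtain ⟨V, hV, hVU⟩ := exists_nhds_split_inv hU
    exact ⟨interior V, isOpen_interior, mem_interior_iff_mem_nhds.2 hV,
      fun v hv w hw => hVU v (interior_subset hv) w (interior_subset hw)⟩
  have hpos : 0 < μ.real V :=
    ENNReal.toReal_pos (hVo.measure_pos μ ⟨1, hV1⟩).ne' (measure_ne_top _ _)
  -- For the indicator of V, ⟪g f, f⟫ = μ(gV ∩ V) tends to μ(V) > 0; once gV meets V, g ∈ VV⁻¹ ⊆ U.
  let f : Lp ℂ 2 μ := indicatorConstLp 2 hVo.measurableSet (measure_ne_top μ V) 1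
  have hinner : ∀ k : K, inner ℂ (leftRegularRepresentation μ k f) f
      = (μ.real ((fun x => k⁻¹ • x) ⁻¹' V ∩ V) : ℂ) := fun k => by
    rw [leftRegularRepresentation_apply, DomMulAct.mk_smul_indicatorConstLp,
      L2.inner_indicatorConstLp_indicatorConstLp]
    simp
  have hself : inner ℂ f f = (μ.real V : ℂ) := by
    rw [L2.inner_indicatorConstLp_indicatorConstLp]
    simp
  have hlim : Tendsto (fun i => inner ℂ (leftRegularRepresentation μ (g i) f) f) l
      (𝓝 (μ.real V : ℂ)) := by
    rw [← hself]
    exact (h f).inner tendsto_const_nhds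
  have hne := hlim.eventually_ne (show (μ.real V : ℂ) ≠ 0 by exact_mod_cast hpos.ne')
  change ∀ᶠ i in l, g i ∈ U
  filter_upwards [hne] with i hi
  rw [hinner] at hi
  obtain ⟨x, hx₁, hx₂⟩ : ((fun x => (g i)⁻¹ • x) ⁻¹' V ∩ V).Nonempty := by
    by_contra hempty
    rw [Set.not_nonempty_iff_eq_empty] at hempty
    exact hi (by rw [hempty]; simp)
  simpa using hVU x hx₂ _ hx₁

/-- Convergence to `1` along all the finite dimensional unitary representations implies
convergence to `1` along all the homomorphisms to compact groups. -/
theorem tendsto_one_of_forall_unitaryLength_lt {G : Type*} [Group G] {z : ℕ → G}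
    (hz : ∀ (n : ℕ) (π : G →* Matrix.unitaryGroup (Fin n) ℂ),
      Tendsto (fun k => unitaryLength (π (z k))) atTop (𝓝 0))
    {K : Type*} [Group K] [TopologicalSpace K] [IsTopologicalGroup K] [CompactSpace K]
    (π : G →* K) : Tendsto (fun k => π (z k)) atTop (𝓝 1) := by
  borelize K
  let μ : Measure K := Measure.haarMeasure ⊤
  have : IsProbabilityMeasure μ := ⟨Measure.haarMeasure_self⟩
  have : Fact ((2 : ENNReal) ≠ ⊤) := ⟨ENNReal.ofNat_ne_top⟩
  refine tendsto_one_of_tendsto_leftRegularRepresentation μ fun f => ?_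
  have hcont : Continuous fun g => leftRegularRepresentation μ g f := by
    simp only [leftRegularRepresentation_apply]
    exact (DomMulAct.continuous_mk.comp continuous_inv).smul continuous_const
  refine tendsto_apply_of_forall_finiteDimensional_invariant μ hcont fun W hfin hW w hw => ?_
  obtain ⟨n, σ, hσ⟩ := exists_monoidHom_unitaryGroup_norm_sub_le
    ((leftRegularRepresentation μ).comp π) W fun x => hW (π x)
  rw [tendsto_iff_norm_sub_tendsto_zero]
  refine squeeze_zero (fun _ => norm_nonneg _) (fun k => hσ (z k) w hw) ?_
  simpa using (hz n σ).mul_const ‖w‖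

theorem mainTheorem4 :
    ∃ z : ℕ → FreeGroup (Fin 2),
      (∀ k : ℕ, z k ≠ 1) ∧
      (∀ (K : Type u) [Group K] [TopologicalSpace K] [IsTopologicalGroup K] [CompactSpace K]
        (π : FreeGroup (Fin 2) →* K), Tendsto (fun k : ℕ => π (z k)) atTop (𝓝 1)) ∧
      (∀ (n : ℕ) (ε : ℝ), 0 < ε → ∃ N : ℕ, ∀ k : ℕ, N ≤ k →
        ∀ π : FreeGroup (Fin 2) →* Matrix.unitaryGroup (Fin n) ℂ,
          unitaryLength (π (z k)) < ε) := by
  obtain ⟨z, hz, hlen⟩ := exists_seq_ne_one_forall_unitaryLength_lt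
  refine ⟨z, hz, fun K _ _ _ _ π => ?_, hlen⟩
  refine tendsto_one_of_forall_unitaryLength_lt (fun n σ => Metric.tendsto_atTop.2 ?_) π
  intro ε hε
  obtain ⟨N, hN⟩ := hlen n ε hε
  refine ⟨N, fun k hk => ?_⟩
  rw [Real.dist_0_eq_abs, abs_of_nonneg (show 0 ≤ unitaryLength _ from norm_nonneg _)]
  exact hN k hk σ
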